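/- Let ${\cal M}=\langle Q,{\sf A},\delta\rangle$ be a Markov decision process (MDP): $Q$ and ${\sf A}$ are finite sets of states and actions, and $\delta:Q\times{\sf A}\to{\cal D}(Q)$, where ${\cal D}(S)$ is the set of probability distributions over $S$. A strategy $\alpha$ assigns to every finite path $q_0a_0q_1\dots q_n$ (with $\delta(q_i,a_i)(q_{i+1})>0$ for all $i<n$) a distribution in ${\cal D}({\sf A})$; it is pure if it always plays some action with probability $1$, and memoryless if it depends only on the last state $q_n$. Given $\mu_0\in{\cal D}(Q)$, let ${\cal M}^\alpha_k(q)$ be the probability to be in $q$ after exactly $k$ steps from $\mu_0$ under $\alpha$. For $T\subseteq Q$ and $X \in {\cal D}(Q)$, let $\mathit{sum}_T(X)=\sum_{q\in T}X(q)$ and $\mathit{max}_T(X)=\max_{q\in T}X(q)$ (with $\max_\emptyset = 0$). For $f\in\{\mathit{sum}_T,\mathit{max}_T\}$, a sequence $(X_i)_{i \ge 0}$ is always $p$-synchronizing according to $f$ if $f(X_i)\geq p$ for all $i\geq 0$. For always synchronizing according to $f$, ${\cal M}$ is, from $\mu_0$, - sure winning if some strategy $\alpha$ makes $({\cal M}^\alpha_k)_k$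 always $1$-synchronizing; - almost-sure winning if some strategy $\alpha$ makes $({\cal M}^\alpha_k)_k$ always $(1-\epsilon)$-synchronizing for all $\epsilon>0$; - limit-sure winning if for all $\epsilon>0$ some strategy $\alpha$ makes $({\cal M}^\alpha_k)_k$ always $(1-\epsilon)$-synchronizing. **Theorem.** For each of the three winning modes, and for always synchronizing according to $\mathit{sum}_T$ as well as according to $\mathit{max}_T$: 1. The membership problem, which is to decide, given an MDP ${\cal M}$, a set $T$ of states and an initial distribution $\mu_0$, whether ${\cal M}$ is winning from $\mu_0$ in this mode, can be solved by a Turing machine in time polynomial in the length of the input. Here ${\cal M}$ is given as the labelled transition system $\{(q,a,q') \mid \delta(q,a)(q')>0\}$ (its transition probabilities may be arbitrary real numbers, only their supports are part of the input), and $\mu_0$ is given by its values, which are rational numbers written as fractions in binary. 2. Pure memoryless strategies are sufficient: for every MDP ${\cal M}$, every $T$, and every (real-valued) $\mu_0$, if ${\cal M}$ is winning from $\mu_0$ in this mode, then it is so by pure memoryless strategies, i.e. the strategies required by the definition of the mode can be chosen pure and memoryless. -/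

import Mathlib

namespace SyncMDP

/-- Probability distributions over a finite set `S`: functions `S → ℝ` with nonnegative values
summing to `1`. -/
abbrev Distr (S : Type*) [Fintype S] : Type _ := stdSimplex ℝ S

/-- A Markov decision process with finite state set `Q` and finite action set `A`, given by its
probabilistic transition function. -/
structure MDP (Q A : Type*) [Fintype Q] [Fintype A] where
  δ : Q → A → Distr Q

namespace MDP

variable {Q A : Type*} [Fintype Q] [Fintype A]

/-- `post(q, a)`, the support of `δ(q, a)`. -/
def post (M : MDP Q A) (q : Q) (a : A) : Set Q := {q' | 0 < (M.δ q a).1 q'}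

/-- `M.Pref n q` is the type of finite paths `q₀ a₀ q₁ … qₙ` of `M` of length `n` with last
state `qₙ = q`, where every `qᵢ₊₁` belongs to `post(qᵢ, aᵢ)`. -/
inductive Pref (M : MDP Q A) : ℕ → Q → Type _
  | start (q : Q) : Pref M 0 q
  | snoc {n : ℕ} {q : Q} (ρ : Pref M n q) (a : A) (q' : Q) (h : q' ∈ M.post q a) :
      Pref M (n + 1) q'

theorem Pref.finite (M : MDP Q A) (n : ℕ) : ∀ q, Finite (M.Pref n q) := by
  induction n with
  | zero =>
    intro q
    refine Finite.of_injective (β := Unit) (fun _ => ()) ?_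
    intro x y _
    cases x
    cases y
    rfl
  | succ n ih =>
    intro q'
    have e : Function.Injective
        (fun ρ : M.Pref (n + 1) q' =>
          (match ρ with
          | .snoc (q := q) ρ a _ _ => (⟨q, ρ, a⟩ : Σ q, M.Pref n q × A))) := by
      intro x y h
      cases x
      cases y
      simp only [Sigma.mk.injEq] at h
      obtain ⟨rfl, h⟩ := h
      simp only [heq_eq_eq, Prod.mk.injEq] at h
      obtain ⟨rfl, rfl⟩ := h
      rfl
    exact Finite.of_injective _ e

noncomputable instance (M : MDP Q A) (n : ℕ) (q : Q) : Fintype (M.Pref n q) :=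
  @Fintype.ofFinite _ (Pref.finite M n q)

/-- A (randomized, history-dependent) strategy: it maps every finite path to a distribution over
the actions. -/
def Strategy (M : MDP Q A) : Type _ := ∀ (n : ℕ) (q : Q), M.Pref n q → Distr A

/-- A strategy is pure if it always plays some action with probability `1`. -/
def Strategy.IsPure {M : MDP Q A} (α : M.Strategy) : Prop :=
  ∀ (n : ℕ) (q : Q) (ρ : M.Pref n q), ∃ a, (α n q ρ).1 a = 1

/-- A strategy is memoryless if it depends only on the last state of the finite path. -/
def Strategy.IsMemoryless {M : MDP Q A} (α : M.Strategy) : Prop :=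
  ∀ (q : Q) (n n' : ℕ) (ρ : M.Pref n q) (ρ' : M.Pref n' q), α n q ρ = α n' q ρ'

/-- The probability of a finite path `q₀ a₀ q₁ … qₙ` from `μ₀` under `α`, that is
`μ₀(q₀) · ∏_{j < n} α(q₀ a₀ … q_j)(a_j) · δ(q_j, a_j)(q_{j+1})`. -/
def pathProb (M : MDP Q A) (μ₀ : Distr Q) (α : M.Strategy) :
    ∀ {n : ℕ} {q : Q}, M.Pref n q → ℝ
  | _, _, .start q => μ₀.1 q
  | _, _, .snoc (n := n) (q := q) ρ a q' _ =>
      pathProb M μ₀ α ρ * ((α n q ρ).1 a * (M.δ q a).1 q')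

/-- The symbolic outcome of `M` from `μ₀` under `α`: `M.outcome μ₀ α k q` is the probability to be
in state `q` after exactly `k` steps, that is the total probability of the finite paths of
length `k` that end in `q`. -/
noncomputable def outcome (M : MDP Q A) (μ₀ : Distr Q) (α : M.Strategy) (k : ℕ) (q : Q) : ℝ :=
  ∑ ρ : M.Pref k q, M.pathProb μ₀ α ρ

end MDP

/-- The two kinds of functions, `sum_T` and `max_T`, that measure synchronization in `T`. -/
inductive SyncFun
  | sum
  | max

/-- `sum_T(X) = ∑_{q ∈ T} X(q)` and `max_T(X) = max_{q ∈ T} X(q)` (which is `0` if `T = ∅`). -/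
noncomputable def SyncFun.eval {Q : Type*} (f : SyncFun) (T : Finset Q) (X : Q → ℝ) : ℝ :=
  match f with
  | .sum => ∑ q ∈ T, X q
  | .max => ⨆ q : T, X q

/-- The sequence `X` is always `p`-synchronizing according to `f`. -/
def AlwaysSync {Q : Type*} (f : (Q → ℝ) → ℝ) (p : ℝ) (X : ℕ → Q → ℝ) : Prop :=
  ∀ i, p ≤ f (X i)

/-- The three winning modes. -/
inductive Mode
  | sure
  | almostSure
  | limitSure

namespace MDP

variable {Q A : Type*} [Fintype Q] [Fintype A]

/-- `M` is winning from `μ₀`, in the given mode, for always synchronizing according to `f`, by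
means of strategies that belong to the class `C`. -/
def AlwaysWinningWith (M : MDP Q A) (C : Set M.Strategy) (f : (Q → ℝ) → ℝ) (μ₀ : Distr Q) :
    Mode → Prop
  | .sure => ∃ α ∈ C, AlwaysSync f 1 (M.outcome μ₀ α)
  | .almostSure => ∃ α ∈ C, ∀ ε : ℝ, 0 < ε → AlwaysSync f (1 - ε) (M.outcome μ₀ α)
  | .limitSure => ∀ ε : ℝ, 0 < ε → ∃ α ∈ C, AlwaysSync f (1 - ε) (M.outcome μ₀ α)

/-- The winning region for always synchronizing according to `f`, in the given mode. -/
def winAlways (M : MDP Q A) (w : Mode) (f : (Q → ℝ) → ℝ) : Set (Distr Q) :=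
  {μ₀ | M.AlwaysWinningWith Set.univ f μ₀ w}

end MDP

/-- An input of the membership problem: an MDP, a rational initial distribution and a target set.
Up to renaming, the states are `0, …, n - 1` and the actions are `0, …, m - 1`. The transition
probabilities are arbitrary real numbers. -/
structure Input where
  n : ℕ
  m : ℕ
  M : MDP (Fin n) (Fin m)
  μ₀ : stdSimplex ℚ (Fin n)
  T : Finset (Fin n)

/-- The initial distribution of an input, with its values read as real numbers. -/
noncomputable def Input.init (x : Input) : Distr (Fin x.n) :=
  ⟨fun q => ((x.μ₀.1 q : ℚ) : ℝ), fun q => Rat.cast_nonneg.2 (x.μ₀.2.1 q), by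
    have h := x.μ₀.2.2
    rw [← Rat.cast_sum, h, Rat.cast_one]⟩

/-- The input alphabet. -/
inductive Letter
  | bit (b : Bool)
  | slash
  | state
  | action

open Classical in
/-- The word that presents an input to a machine. It lists, for each state `q`, whether `q ∈ T`,
the number `μ₀(q)` as a fraction (numerator and denominator in binary), and for each action `a`
the row of the `n` bits that tell whether `(q, a, q')` is a transition, that is whether
`q' ∈ post(q, a)`. Thus the MDP is given as a labelled transition system: of the transition
probabilities only the supports are presented. -/
noncomputable def Input.encode (x : Input) : List Letter :=
  (List.finRange x.n).flatMap fun q =>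
    [Letter.state, Letter.bit (decide (q ∈ x.T))]
      ++ (Computability.encodeNat (x.μ₀.1 q).num.natAbs).map Letter.bit
      ++ [Letter.slash]
      ++ (Computability.encodeNat (x.μ₀.1 q).den).map Letter.bit
      ++ (List.finRange x.m).flatMap fun a =>
          Letter.action :: (List.finRange x.n).map fun q' =>
            Letter.bit (decide (q' ∈ x.M.post q a))

open Classical in
/-- The property `P` of the objects of `α`, presented as words by `enc`, is decided by a
(multi-stack) Turing machine that runs in time polynomial in the length of the word. -/
def DecidableInPolyTime {α Γ : Type} (enc : α → List Γ) (P : α → Prop) : Prop :=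
  Nonempty (Turing.TM2ComputableInPolyTime enc Computability.encodeBool fun a => decide (P a))

end SyncMDP

/-! The three modes coincide. Call `S` safe if each of its states has an action whose support fits
`S`: it lies in `S` and, for `max`, has at most one element. By `mem_winAlways_iff`, winning in any
mode means that the support of `μ₀` fits some safe `S ⊆ T`.

Given such an `S`, playing a fixed good action in each state is pure and memoryless and keeps the
support fitting `S`, which is sure winning (`winning_of_isSafe`). Conversely, it is enough to start
from limit-sure winning, the weakest mode. For `sum` (`exists_isSafe_sum`), call a state negligible
if its probability is `O(ε)`, uniformly over all times and all strategies that are always `(1 -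
ε)`-synchronizing. States outside `T` are negligible, initial ones are not, and a state each of
whose actions may lead to a negligible state is negligible, so the other states form a safe set. For
`max` (`exists_isSafe_max`), the finitely many transition probabilities below `1` are bounded away
from `1`, so for small `ε` the states that carry almost all mass at successive times are linked by
transitions of probability `1`.

Membership is thus a greatest fixpoint: delete from `T` the states without a good action until
nothing changes, then test the initial support. There are at most `n + 1` rounds, and a machine with
four stacks performs each in linear time, which gives a quadratic bound. -/

namespace SyncMDP

open Finset

/-! ### Outcomes as one-step flows between states -/

namespace MDP

variable {Q A : Type*} [Fintype Q] [Fintype A]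

theorem pathProb_nonneg (M : MDP Q A) (μ₀ : Distr Q) (α : M.Strategy) {n : ℕ} {q : Q}
    (ρ : M.Pref n q) : 0 ≤ M.pathProb μ₀ α ρ := by
  induction ρ with
  | start q => exact μ₀.2.1 q
  | snoc ρ a q' h ih =>
    exact mul_nonneg ih (mul_nonneg ((α _ _ ρ).2.1 a) ((M.δ _ a).2.1 q'))

/-- The probability to be in state `q` after `k` steps and to play `a` next. -/
noncomputable def flow (M : MDP Q A) (μ₀ : Distr Q) (α : M.Strategy) (k : ℕ) (q : Q) (a : A) : ℝ :=
  ∑ ρ : M.Pref k q, M.pathProb μ₀ α ρ * (α k q ρ).1 a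

theorem flow_nonneg (M : MDP Q A) (μ₀ : Distr Q) (α : M.Strategy) (k : ℕ) (q : Q) (a : A) :
    0 ≤ M.flow μ₀ α k q a :=
  sum_nonneg fun ρ _ => mul_nonneg (M.pathProb_nonneg μ₀ α ρ) ((α k q ρ).2.1 a)

theorem sum_flow (M : MDP Q A) (μ₀ : Distr Q) (α : M.Strategy) (k : ℕ) (q : Q) :
    ∑ a, M.flow μ₀ α k q a = M.outcome μ₀ α k q := by
  unfold flow outcome
  rw [sum_comm]
  refine sum_congr rfl fun ρ _ => ?_
  rw [← mul_sum, (α k q ρ).2.2, mul_one]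

theorem outcome_nonneg (M : MDP Q A) (μ₀ : Distr Q) (α : M.Strategy) (k : ℕ) (q : Q) :
    0 ≤ M.outcome μ₀ α k q :=
  sum_nonneg fun ρ _ => M.pathProb_nonneg μ₀ α ρ

theorem outcome_zero (M : MDP Q A) (μ₀ : Distr Q) (α : M.Strategy) (q : Q) :
    M.outcome μ₀ α 0 q = μ₀.1 q := by
  unfold outcome
  rw [Fintype.sum_eq_single (Pref.start q)]
  · rfl
  · intro ρ h
    cases ρ
    exact absurd rfl h

/-- The paths of length `n + 1` that end in `q'`. -/
def prefSuccEquiv (M : MDP Q A) (n : ℕ) (q' : Q) :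
    (Σ p : Σ q, M.Pref n q, {a // q' ∈ M.post p.1 a}) ≃ M.Pref (n + 1) q' where
  toFun p := .snoc p.1.2 p.2.1 q' p.2.2
  invFun
    | .snoc ρ a _ h => ⟨⟨_, ρ⟩, a, h⟩
  left_inv _ := rfl
  right_inv ρ := by cases ρ; rfl

/-- Splitting off the last step of each path leaves a recursion in which the history enters only
through `flow`. -/
theorem outcome_succ (M : MDP Q A) (μ₀ : Distr Q) (α : M.Strategy) (k : ℕ) (q' : Q) :
    M.outcome μ₀ α (k + 1) q' = ∑ q, ∑ a, M.flow μ₀ α k q a * (M.δ q a).1 q' := by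
  classical
  have hz : ∀ q a, q' ∉ M.post q a → (M.δ q a).1 q' = 0 := fun q a h =>
    le_antisymm (not_lt.1 h) ((M.δ q a).2.1 q')
  unfold outcome flow
  rw [← (M.prefSuccEquiv k q').sum_comp, Fintype.sum_sigma, Fintype.sum_sigma]
  refine sum_congr rfl fun q _ => ?_
  simp only [sum_mul]
  rw [sum_comm]
  refine sum_congr rfl fun ρ _ => ?_
  have : ∀ a, q' ∉ M.post q a →
      M.pathProb μ₀ α ρ * (α k q ρ).1 a * (M.δ q a).1 q' = 0 := fun a h => by
    rw [hz q a h, mul_zero]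
  -- Actions that cannot lead to `q'` contribute zero, so the sum may be restricted to the possible
  -- last steps.
  rw [← Finset.sum_subset (Finset.subset_univ (Finset.univ.filter fun a => q' ∈ M.post q a))
    (fun a _ h => this a (by simpa using h))]
  rw [← Finset.sum_subtype_eq_sum_filter, Finset.subtype_univ]
  refine sum_congr rfl fun a _ => ?_
  rw [mul_assoc]
  rfl

theorem sum_outcome (M : MDP Q A) (μ₀ : Distr Q) (α : M.Strategy) (k : ℕ) :
    ∑ q, M.outcome μ₀ α k q = 1 := by
  induction k with
  | zero => simpa only [outcome_zero] using μ₀.2.2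
  | succ k ih =>
    simp only [outcome_succ]
    rw [sum_comm, ← ih]
    refine sum_congr rfl fun q _ => ?_
    rw [sum_comm, ← sum_flow]
    refine sum_congr rfl fun a _ => ?_
    rw [← mul_sum, (M.δ q a).2.2, mul_one]

theorem flow_mul_le_outcome (M : MDP Q A) (μ₀ : Distr Q) (α : M.Strategy) (k : ℕ) (q : Q) (a : A)
    (q' : Q) : M.flow μ₀ α k q a * (M.δ q a).1 q' ≤ M.outcome μ₀ α (k + 1) q' := by
  have h0 : ∀ q a, 0 ≤ M.flow μ₀ α k q a * (M.δ q a).1 q' := fun q a =>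
    mul_nonneg (M.flow_nonneg μ₀ α k q a) ((M.δ q a).2.1 q')
  rw [outcome_succ]
  exact (single_le_sum (f := fun a => M.flow μ₀ α k q a * (M.δ q a).1 q')
    (fun a _ => h0 q a) (mem_univ a)).trans
    (single_le_sum (f := fun q => ∑ a, M.flow μ₀ α k q a * (M.δ q a).1 q')
      (fun q _ => sum_nonneg fun a _ => h0 q a) (mem_univ q))

end MDP

/-! ### Supports and safe sets: safety suffices -/

/-- The states of positive probability. -/
def Distr.supp {S : Type*} [Fintype S] (X : Distr S) : Set S := {q | 0 < X.1 q}

theorem Distr.le_one {S : Type*} [Fintype S] (X : Distr S) (q : S) : X.1 q ≤ 1 := by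
  rw [← X.2.2]
  exact single_le_sum (fun q _ => X.2.1 q) (mem_univ q)

theorem Distr.supp_nonempty {S : Type*} [Fintype S] (X : Distr S) : X.supp.Nonempty := by
  by_contra! h
  have h0 : ∀ q, X.1 q = 0 := fun q =>
    le_antisymm (not_lt.1 fun hq => (h ▸ hq : q ∈ (∅ : Set S))) (X.2.1 q)
  have h1 := X.2.2
  simp only [h0, sum_const_zero] at h1
  exact zero_ne_one h1

theorem Distr.eq_of_eq_one {S : Type*} [Fintype S] (X : Distr S) {q q' : S} (h : X.1 q = 1)
    (h' : q' ∈ X.supp) : q' = q := by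
  classical
  by_contra hne
  have h2 : X.1 q + X.1 q' ≤ 1 := by
    rw [← X.2.2, ← sum_pair (Ne.symm hne)]
    exact sum_le_sum_of_subset_of_nonneg (subset_univ _) fun q _ _ => X.2.1 q
  have : 0 < X.1 q' := h'
  linarith

/-- A support `R` is compatible with staying in `S`: it is a part of `S` and, if synchronization
is measured by `max`, it has at most one element. -/
def Fits {Q : Type*} (f : SyncFun) (R S : Set Q) : Prop :=
  R ⊆ S ∧ (f = .max → R.Subsingleton)

theorem Fits.mono {Q : Type*} {f : SyncFun} {R S S' : Set Q} (h : Fits f R S) (hS : S ⊆ S') :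
    Fits f R S' :=
  ⟨h.1.trans hS, h.2⟩

namespace MDP

variable {Q A : Type*} [Fintype Q] [Fintype A]

/-- From every state of `S`, some action leads to a support that fits `S`. -/
def IsSafe (M : MDP Q A) (f : SyncFun) (S : Set Q) : Prop :=
  ∀ q ∈ S, ∃ a, Fits f (M.post q a) S

theorem AlwaysWinningWith.of_sure {M : MDP Q A} {C : Set M.Strategy} {f : (Q → ℝ) → ℝ}
    {μ₀ : Distr Q} (h : M.AlwaysWinningWith C f μ₀ .sure) (w : Mode) :
    M.AlwaysWinningWith C f μ₀ w := by
  obtain ⟨α, hC, hα⟩ := h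
  cases w
  · exact ⟨α, hC, hα⟩
  · exact ⟨α, hC, fun ε hε i => le_trans (by linarith) (hα i)⟩
  · exact fun ε hε => ⟨α, hC, fun i => le_trans (by linarith) (hα i)⟩

theorem AlwaysWinningWith.limitSure {M : MDP Q A} {C : Set M.Strategy} {f : (Q → ℝ) → ℝ}
    {μ₀ : Distr Q} {w : Mode} (h : M.AlwaysWinningWith C f μ₀ w) :
    M.AlwaysWinningWith C f μ₀ .limitSure := by
  cases w
  · exact h.of_sure _
  · obtain ⟨α, hC, hα⟩ := h
    exact fun ε hε => ⟨α, hC, hα ε hε⟩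
  · exact h

theorem winning_of_isSafe (M : MDP Q A) (f : SyncFun) (T : Finset Q) (μ₀ : Distr Q) {S : Set Q}
    (hT : S ⊆ T) (h0 : Fits f μ₀.supp S) (hS : M.IsSafe f S) (w : Mode) :
    M.AlwaysWinningWith {α | α.IsPure ∧ α.IsMemoryless} (f.eval T) μ₀ w := by
  classical
  refine AlwaysWinningWith.of_sure ?_ w
  obtain ⟨q₀, hq₀⟩ := μ₀.supp_nonempty
  -- The action `a₀` is only a filler for states outside `S`, which are never reached.
  obtain ⟨a₀, -⟩ := hS q₀ (h0.1 hq₀)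
  have hc : ∀ q, ∃ a, q ∈ S → Fits f (M.post q a) S := fun q => by
    by_cases hq : q ∈ S
    · obtain ⟨a, ha⟩ := hS q hq
      exact ⟨a, fun _ => ha⟩
    · exact ⟨a₀, fun h => absurd h hq⟩
  choose c hc using hc
  let α : M.Strategy := fun _ q _ => ⟨Pi.single (c q) 1, single_mem_stdSimplex ℝ (c q)⟩
  have hflow : ∀ k q a, 0 < M.flow μ₀ α k q a → a = c q ∧ 0 < M.outcome μ₀ α k q := by
    intro k q a h
    refine ⟨?_, h.trans_le ?_⟩
    · by_contra hne
      refine h.ne' (sum_eq_zero fun ρ _ => ?_)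
      have : (α k q ρ).1 a = 0 := Pi.single_eq_of_ne hne _
      rw [this, mul_zero]
    · rw [← sum_flow]
      exact single_le_sum (fun a _ => M.flow_nonneg μ₀ α k q a) (mem_univ a)
  have hstep : ∀ k q', 0 < M.outcome μ₀ α (k + 1) q' →
      ∃ q, 0 < M.outcome μ₀ α k q ∧ q' ∈ M.post q (c q) := by
    intro k q' h
    rw [outcome_succ] at h
    obtain ⟨q, -, hq⟩ := exists_lt_of_sum_lt (s := univ) (f := fun _ : Q => (0 : ℝ))
      (by simpa using h)
    obtain ⟨a, -, ha⟩ := exists_lt_of_sum_lt (s := univ) (f := fun _ : A => (0 : ℝ))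
      (by simpa using hq)
    have h1 := pos_of_mul_pos_left ha ((M.δ q a).2.1 q')
    have h2 := pos_of_mul_pos_right ha (M.flow_nonneg μ₀ α k q a)
    obtain ⟨rfl, h3⟩ := hflow k q a h1
    exact ⟨q, h3, h2⟩
  have hfits : ∀ k, Fits f {q | 0 < M.outcome μ₀ α k q} S := by
    intro k
    induction k with
    | zero =>
      simp only [outcome_zero]
      exact h0
    | succ k ih =>
      refine ⟨fun q' h => ?_, fun hf q₁ h₁ q₂ h₂ => ?_⟩
      · obtain ⟨q, hq, hq'⟩ := hstep k q' h
        exact (hc q (ih.1 hq)).1 hq'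
      · obtain ⟨q, hq, hq₁⟩ := hstep k q₁ h₁
        obtain ⟨q', hq', hq₂⟩ := hstep k q₂ h₂
        obtain rfl := ih.2 hf hq hq'
        exact (hc q (ih.1 hq)).2 hf hq₁ hq₂
  refine ⟨α, ⟨fun n q ρ => ⟨c q, by simp [α]⟩, fun q n n' ρ ρ' => rfl⟩, fun k => ?_⟩
  have hsupp : ∀ q, 0 < M.outcome μ₀ α k q → q ∈ T := fun q hq => hT ((hfits k).1 hq)
  cases f with
  | sum =>
    refine (M.sum_outcome μ₀ α k).ge.trans (le_of_eq (Eq.symm ?_))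
    exact sum_subset (subset_univ T) fun q _ hq =>
      le_antisymm (not_lt.1 fun h => hq (hsupp q h)) (M.outcome_nonneg μ₀ α k q)
  | max =>
    obtain ⟨q, hq⟩ := Distr.supp_nonempty (⟨M.outcome μ₀ α k, M.outcome_nonneg μ₀ α k,
      M.sum_outcome μ₀ α k⟩ : Distr Q)
    have h1 : M.outcome μ₀ α k q = 1 := by
      rw [← M.sum_outcome μ₀ α k, Fintype.sum_eq_single q]
      intro q' hne
      exact le_antisymm (not_lt.1 fun h => hne ((hfits k).2 rfl h hq)) (M.outcome_nonneg μ₀ α k q')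
    rw [← h1]
    exact le_ciSup (f := fun q : T => M.outcome μ₀ α k q) (Set.finite_range _).bddAbove
      ⟨q, hsupp q hq⟩

/-! ### Safety is necessary, even for limit-sure winning -/

/-- The set `S` of non-negligible states works: no `C` bounds their probability by `C * ε` for all
`ε`, all strategies in `V ε` and all times. -/
theorem exists_isSafe_sum (M : MDP Q A) (T : Finset Q) (μ₀ : Distr Q)
    (h : M.AlwaysWinningWith Set.univ (SyncFun.sum.eval T) μ₀ .limitSure) :
    ∃ S : Set Q, S ⊆ T ∧ Fits .sum μ₀.supp S ∧ M.IsSafe .sum S := by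
  classical
  let V : ℝ → Set M.Strategy := fun ε =>
    {α | AlwaysSync (SyncFun.sum.eval T) (1 - ε) (M.outcome μ₀ α)}
  let S : Set Q := {q | ∀ C : ℝ, ∃ ε > 0, ∃ α ∈ V ε, ∃ k, C * ε < M.outcome μ₀ α k q}
  refine ⟨S, fun q hq => ?_, ⟨fun q hq C => ?_, by simp⟩, fun q hq => ?_⟩
  · by_contra hqT
    -- The constant `1` suffices outside `T`, where the total mass is at most `ε`.
    obtain ⟨ε, hε, α, hα, k, hk⟩ := hq 1
    have h1 : 1 - ε ≤ ∑ q ∈ T, M.outcome μ₀ α k q := hα k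
    have h2 : M.outcome μ₀ α k q + ∑ q ∈ T, M.outcome μ₀ α k q ≤ 1 := by
      rw [← M.sum_outcome μ₀ α k, ← sum_insert (by simpa using hqT)]
      exact sum_le_sum_of_subset_of_nonneg (subset_univ _) fun q _ _ => M.outcome_nonneg μ₀ α k q
    linarith
  · have hq : 0 < μ₀.1 q := hq
    obtain ⟨ε, hε, hlt⟩ : ∃ ε > 0, C * ε < μ₀.1 q := by
      refine ⟨μ₀.1 q / (2 * (|C| + 1)), by positivity, ?_⟩
      rw [← mul_div_assoc, div_lt_iff₀ (by positivity)]
      nlinarith [le_abs_self C, abs_nonneg C]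
    obtain ⟨α, -, hα⟩ := h ε hε
    exact ⟨ε, hε, α, hα, 0, by rwa [outcome_zero]⟩
  · by_contra! hno
    have : ∀ a, ∃ q' ∈ M.post q a, ∃ C : ℝ, ∀ ε > 0, ∀ α ∈ V ε, ∀ k,
        M.outcome μ₀ α k q' ≤ C * ε := by
      intro a
      have h1 : ¬ M.post q a ⊆ S := fun h1 => hno a ⟨h1, by simp⟩
      obtain ⟨q', hq', hS⟩ := Set.not_subset.1 h1
      refine ⟨q', hq', ?_⟩
      simpa only [S, Set.mem_ofPred_eq, not_forall, not_exists, not_and, not_lt] using hS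
    choose g hg C hC using this
    -- The flow through `a` is at most `C a * ε / δ(q, a)(g a)`; summing over the actions makes `q`
    -- itself negligible.
    obtain ⟨ε, hε, α, hα, k, hk⟩ := hq (∑ a, C a / (M.δ q a).1 (g a))
    refine hk.not_ge ?_
    rw [← sum_flow, sum_mul]
    refine sum_le_sum fun a _ => ?_
    have hpos : 0 < (M.δ q a).1 (g a) := hg a
    rw [div_mul_eq_mul_div, le_div_iff₀ hpos]
    exact (M.flow_mul_le_outcome μ₀ α k q a (g a)).trans (hC a ε hε α hα (k + 1))

theorem exists_gap {ι : Type*} [Finite ι] (g : ι → ℝ) :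
    ∃ η > 0, η ≤ 1 ∧ ∀ i, g i < 1 → g i ≤ 1 - η := by
  have := Fintype.ofFinite ι
  have h : ∀ i, ∃ η > 0, g i < 1 → g i ≤ 1 - η := fun i => by
    by_cases hi : g i < 1
    · exact ⟨1 - g i, by linarith, fun _ => by linarith⟩
    · exact ⟨1, one_pos, fun h => absurd h hi⟩
  choose η hη hle using h
  -- The inserted `1` covers an empty `ι` and ensures `η ≤ 1`.
  refine ⟨(insert 1 (univ.image η)).min' (insert_nonempty _ _), ?_, ?_, fun i hi => ?_⟩
  · have := min'_mem (insert 1 (univ.image η)) (insert_nonempty _ _)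
    rcases mem_insert.1 this with h | h
    · rw [h]; exact one_pos
    · obtain ⟨i, -, hi⟩ := mem_image.1 h
      rw [← hi]; exact hη i
  · exact min'_le _ _ (mem_insert_self _ _)
  · have := min'_le (insert 1 (univ.image η)) (η i)
      (mem_insert_of_mem (mem_image_of_mem η (mem_univ i)))
    linarith [hle i hi]

/-- One strategy for one small `ε` is enough: the states `s k` of mass at least `1 - ε` form the
safe set. -/
theorem exists_isSafe_max (M : MDP Q A) (T : Finset Q) (μ₀ : Distr Q)
    (h : M.AlwaysWinningWith Set.univ (SyncFun.max.eval T) μ₀ .limitSure) :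
    ∃ S : Set Q, S ⊆ T ∧ Fits .max μ₀.supp S ∧ M.IsSafe .max S := by
  classical
  obtain ⟨η₁, hη₁, hη₁1, hgap₁⟩ := exists_gap fun i : Q × A × Q => (M.δ i.1 i.2.1).1 i.2.2
  obtain ⟨η₂, hη₂, -, hgap₂⟩ := exists_gap μ₀.1
  obtain ⟨ε, hε, hε₁, hε₂⟩ : ∃ ε > 0, 2 * ε < η₁ ∧ ε < η₂ :=
    ⟨min η₁ η₂ / 3, by positivity, by linarith [min_le_left η₁ η₂], by
      linarith [min_le_right η₁ η₂]⟩
  obtain ⟨α, -, hα⟩ := h ε hε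
  have hex : ∀ k, ∃ q ∈ T, 1 - ε ≤ M.outcome μ₀ α k q := by
    intro k
    have hk : 1 - ε ≤ ⨆ q : T, M.outcome μ₀ α k q := hα k
    rcases isEmpty_or_nonempty T with hT | hT
    · rw [Real.iSup_of_isEmpty] at hk
      linarith
    · obtain ⟨q, hq⟩ := exists_eq_ciSup_of_finite (f := fun q : T => M.outcome μ₀ α k q)
      exact ⟨q, q.2, hk.trans hq.ge⟩
  choose s hsT hs using hex
  refine ⟨Set.range s, Set.range_subset_iff.2 hsT, ?_, ?_⟩
  · have h1 : μ₀.1 (s 0) = 1 := by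
      refine le_antisymm (μ₀.le_one _) (not_lt.1 fun hlt => ?_)
      have := hs 0
      rw [outcome_zero] at this
      linarith [hgap₂ _ hlt]
    refine ⟨fun q hq => ⟨0, (μ₀.eq_of_eq_one h1 hq).symm⟩, fun _ q hq q' hq' => ?_⟩
    rw [μ₀.eq_of_eq_one h1 hq, μ₀.eq_of_eq_one h1 hq']
  · rintro _ ⟨k, rfl⟩
    obtain ⟨a, ha⟩ : ∃ a, (M.δ (s k) a).1 (s (k + 1)) = 1 := by
      by_contra! hne
      have hδ : ∀ a, (M.δ (s k) a).1 (s (k + 1)) ≤ 1 - η₁ := fun a =>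
        hgap₁ (s k, a, s (k + 1)) (lt_of_le_of_ne ((M.δ (s k) a).le_one _) (hne a))
      have h1 : M.outcome μ₀ α (k + 1) (s (k + 1)) ≤
          M.outcome μ₀ α k (s k) * (1 - η₁) + ∑ q ∈ univ.erase (s k), M.outcome μ₀ α k q := by
        rw [outcome_succ, ← add_sum_erase _ _ (mem_univ (s k)), ← sum_flow, sum_mul]
        refine add_le_add (sum_le_sum fun a _ => ?_) (sum_le_sum fun q _ => ?_)
        · exact mul_le_mul_of_nonneg_left (hδ a) (M.flow_nonneg ..)
        · rw [← sum_flow]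
          exact sum_le_sum fun a _ =>
            mul_le_of_le_one_right (M.flow_nonneg ..) ((M.δ q a).le_one _)
      have h2 : M.outcome μ₀ α k (s k) + ∑ q ∈ univ.erase (s k), M.outcome μ₀ α k q = 1 := by
        rw [add_sum_erase _ _ (mem_univ (s k)), sum_outcome]
      have h3 : 0 ≤ ∑ q ∈ univ.erase (s k), M.outcome μ₀ α k q :=
        sum_nonneg fun q _ => M.outcome_nonneg ..
      -- With `p` the mass of `s k`, `1 - ε ≤ p * (1 - η₁) + (1 - p)`, so `(1 - ε) * η₁ ≤ p * η₁ ≤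
      -- ε`. Since `η₁ ≤ 1`, this contradicts `2 * ε < η₁`.
      nlinarith [hs k, hs (k + 1)]
    refine ⟨a, fun q hq => ⟨k + 1, ((M.δ (s k) a).eq_of_eq_one ha hq).symm⟩,
      fun _ q hq q' hq' => ?_⟩
    rw [(M.δ (s k) a).eq_of_eq_one ha hq, (M.δ (s k) a).eq_of_eq_one ha hq']

theorem mem_winAlways_iff (M : MDP Q A) (f : SyncFun) (T : Finset Q) (μ₀ : Distr Q) (w : Mode) :
    μ₀ ∈ M.winAlways w (f.eval T) ↔ ∃ S : Set Q, S ⊆ T ∧ Fits f μ₀.supp S ∧ M.IsSafe f S := by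
  constructor
  · intro h
    cases f
    · exact M.exists_isSafe_sum T μ₀ (AlwaysWinningWith.limitSure h)
    · exact M.exists_isSafe_max T μ₀ (AlwaysWinningWith.limitSure h)
  · rintro ⟨S, hT, h0, hS⟩
    obtain ⟨α, -, hα⟩ := M.winning_of_isSafe f T μ₀ hT h0 hS .sure
    exact AlwaysWinningWith.of_sure ⟨α, Set.mem_univ α, hα⟩ w

end MDP
-- Runs with step counts, and the finite summary of a row
open Turing

/-- `ReachesIn f t a b`: iterating the partial function `f` from `a` leads to `b` in at most `t`
steps. -/
def ReachesIn {σ : Type*} (f : σ → Option σ) (t : ℕ) (a b : σ) : Prop :=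
  ∃ k ≤ t, (flip bind f)^[k] (some a) = some b

namespace ReachesIn

variable {σ : Type*} {f : σ → Option σ} {s t : ℕ} {a b c : σ}

theorem refl (a : σ) : ReachesIn f 0 a a := ⟨0, le_rfl, rfl⟩

theorem single (h : f a = some b) : ReachesIn f 1 a b := ⟨1, le_rfl, h⟩

theorem trans (h₁ : ReachesIn f s a b) (h₂ : ReachesIn f t b c) : ReachesIn f (s + t) a c := by
  obtain ⟨k, hk, h₁⟩ := h₁
  obtain ⟨l, hl, h₂⟩ := h₂
  exact ⟨l + k, by omega, by rw [Function.iterate_add_apply, h₁, h₂]⟩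

theorem mono (h : ReachesIn f s a b) (hst : s ≤ t) : ReachesIn f t a b :=
  let ⟨k, hk, h⟩ := h
  ⟨k, hk.trans hst, h⟩

theorem head (h : f a = some b) (h' : ReachesIn f t b c) : ReachesIn f (t + 1) a c :=
  ((single h).trans h').mono (Nat.add_comm _ _).le

end ReachesIn

/-- What a machine remembers of a row of bits, each of them paired with a mark: whether all ones
are marked, and whether there is at least one, at least two ones. -/
structure Status where
  inside : Bool
  one : Bool
  two : Bool

instance : Finite Status :=
  Finite.of_injective (fun s => (s.inside, s.one, s.two)) fun s s' h => by
    cases s; cases s'; simpa using h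

namespace Status

def start : Status := ⟨true, false, false⟩

def add (s : Status) (b m : Bool) : Status :=
  if b then ⟨s.inside && m, true, s.two || s.one⟩ else s

def good (f : SyncFun) (s : Status) : Bool :=
  match f with
  | .sum => s.inside
  | .max => s.inside && !s.two

variable {ι : Type*} (r S : ι → Bool)

/-- The status of the row of the bits `r i`, with marks `S i`, for `i` in `l`. -/
def ofList (l : List ι) : Status := l.foldr (fun i s => s.add (r i) (S i)) start

theorem ofList_cons (i : ι) (l : List ι) :
    ofList r S (i :: l) = (ofList r S l).add (r i) (S i) := rfl

theorem inside_ofList (l : List ι) :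
    (ofList r S l).inside = true ↔ ∀ i ∈ l, r i = true → S i = true := by
  induction l with
  | nil => simp [ofList, start]
  | cons i l ih =>
    rw [ofList_cons, add]
    cases h : r i <;> simp [h, ih, and_comm]

theorem one_ofList (l : List ι) : (ofList r S l).one = true ↔ ∃ i ∈ l, r i = true := by
  induction l with
  | nil => simp [ofList, start]
  | cons i l ih =>
    rw [ofList_cons, add]
    cases h : r i <;> simp [h, ih]

theorem two_ofList {l : List ι} (hl : l.Nodup) :
    (ofList r S l).two = false ↔ ∀ i ∈ l, ∀ j ∈ l, r i = true → r j = true → i = j := by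
  induction l with
  | nil => simp [ofList, start]
  | cons i l ih =>
    obtain ⟨hi, hl⟩ := List.nodup_cons.1 hl
    have h1 : (ofList r S l).one = false ↔ ∀ j ∈ l, r j = false := by
      rw [← Bool.not_eq_true, one_ofList]
      simp
    rw [ofList_cons, add]
    cases h : r i
    · simp [h, ih hl]
    · simp only [if_true, Bool.or_eq_false_iff, ih hl, h1, List.forall_mem_cons, h]
      grind

theorem good_ofList {ι : Type*} (r S : ι → Bool) {l : List ι} (hl : l.Nodup)
    (hmem : ∀ i, i ∈ l) (f : SyncFun) :
    (ofList r S l).good f = true ↔ Fits f {i | r i = true} {i | S i = true} := by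
  have h1 := inside_ofList r S l
  have h2 := two_ofList r S hl
  simp only [hmem, true_imp_iff] at h1 h2
  have h3 : {i | r i = true}.Subsingleton ↔ (ofList r S l).two = false := by
    rw [h2]
    exact ⟨fun h i j hi hj => h hi hj, fun h i hi j hj => h i j hi hj⟩
  cases f
  · simp only [good, h1, Fits, reduceCtorEq, false_imp_iff, and_true]
    rfl
  · simp only [good, Bool.and_eq_true, h1, Bool.not_eq_true', Fits, true_imp_iff, h3]
    rfl

end Status

/-! ### The machine -/

instance : Finite Letter :=
  Finite.of_surjective
    (fun x : Option (Option (Option Bool)) => match x with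
      | none => .slash
      | some none => .state
      | some (some none) => .action
      | some (some (some b)) => .bit b)
    (by
      rintro (b | _ | _ | _)
      exacts [⟨some (some (some b)), rfl⟩, ⟨none, rfl⟩, ⟨some none, rfl⟩,
        ⟨some (some none), rfl⟩])

noncomputable instance : Fintype Letter := Fintype.ofFinite _

/-- The stacks: the word and its part already read, the marks and those already used. -/
inductive Stack
  | word
  | done
  | marks
  | used
  deriving DecidableEq

instance : Fintype Stack := ⟨{.word, .done, .marks, .used}, fun k => by cases k <;> decide⟩

@[reducible]
def Stack.Alphabet : Stack → Type
  | .word => Letter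
  | .done => Letter
  | .marks => Bool
  | .used => Bool

/-- The program labels: reading the marks, scanning the word from right to left, moving back the
used marks, and emptying stacks. -/
inductive Label
  | load
  | scan
  | rewind
  | clearMarks
  | clearWord
  deriving DecidableEq

instance : Fintype Label :=
  ⟨{.load, .scan, .rewind, .clearMarks, .clearWord}, fun l => by cases l <;> decide⟩

/-- The finite memory between two steps. -/
structure Acc where
  /-- the last letter was `Letter.state` (while reading the marks) -/
  atFlag : Bool
  /-- the status of the current row -/
  row : Status
  /-- the current state has a good action -/
  ok : Bool
  /-- at least one bit was read since the last separator -/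
  bits : Bool
  /-- at least two bits were read since the last separator -/
  more : Bool
  /-- a mark was removed -/
  changed : Bool
  /-- the status of the support of the initial distribution -/
  init : Status

instance : Finite Acc :=
  Finite.of_injective
    (fun a => (a.atFlag, a.row, a.ok, a.bits, a.more, a.changed, a.init)) fun a a' h => by
    cases a; cases a'; simpa using h

namespace Acc

/-- Memory at a separator. -/
def clean (ok changed : Bool) (init : Status) : Acc :=
  ⟨false, .start, ok, false, false, changed, init⟩

def start : Acc := clean false false .start

/-- On words of inputs the default mark is needed only outside the rows, where the row status is
later discarded. `more` takes the old value of `bits`. -/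
def bit (a : Acc) (b : Bool) (m : Option Bool) : Acc :=
  { a with row := a.row.add b (m.getD false), bits := true, more := a.bits }

/-- Scanning goes from right to left, so `.action` is met when its row is complete, while `.slash`
discards the denominator. -/
def sep (f : SyncFun) (a : Acc) (x : Letter) : Acc :=
  match x with
  | .action => clean (a.ok || a.row.good f) a.changed a.init
  | _ => clean a.ok a.changed a.init

/-- The bits just read are the flag and the numerator, so `more` says that the numerator is
nonempty, that is, nonzero. `init` uses the updated flags; it is evaluated only after a round that
changed none. -/
def endState (a : Acc) (flag : Bool) : Acc :=
  clean false (a.changed || (flag && !a.ok)) (a.init.add a.more (flag && a.ok))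

end Acc

/-- The finite memory of the machine. -/
structure Var where
  letter : Option Letter
  mark : Option Bool
  acc : Acc

instance : Finite Var :=
  Finite.of_injective (fun v => (v.letter, v.mark, v.acc)) fun v v' h => by
    cases v; cases v'; simpa using h

noncomputable instance : Fintype Var := Fintype.ofFinite _

def Letter.toBool : Letter → Bool
  | .bit b => b
  | _ => false

def Letter.isBit : Letter → Bool
  | .bit _ => true
  | _ => false

def Letter.isState : Letter → Bool
  | .state => true
  | _ => false

namespace Var

/-- Both registers are empty between steps, so `acc` alone is the memory carried along. -/
def idle (a : Acc) : Var := ⟨none, none, a⟩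

def getLetter (v : Var) : Letter := v.letter.getD .slash

def getMark (v : Var) : Bool := v.mark.getD false

def readLetter (v : Var) (x : Option Letter) : Var := { v with letter := x }

def readMark (v : Var) (m : Option Bool) : Var := { v with mark := m }

def forget (v : Var) : Var := idle v.acc

end Var

abbrev Prog : Type := TM2.Stmt Stack.Alphabet Label Var

open TM2.Stmt in
/-- The program of the machine. -/
def prog (f : SyncFun) : Label → Prog
  | .load =>
    pop .word Var.readLetter <|
    branch (fun v => v.letter.isSome)
      (push .done Var.getLetter <|
        branch (fun v => v.acc.atFlag)
          (push .marks (fun v => v.getLetter.toBool) <|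
            load (fun v => .idle { v.acc with atFlag := v.getLetter.isState }) <|
            goto fun _ => .load)
          (load (fun v => .idle { v.acc with atFlag := v.getLetter.isState }) <|
            goto fun _ => .load))
      (load (fun _ => .idle .start) <| goto fun _ => .scan)
  | .scan =>
    pop .done Var.readLetter <|
    branch (fun v => v.letter.isSome)
      (branch (fun v => v.getLetter.isBit)
        (pop .marks Var.readMark <|
          push .word Var.getLetter <|
          branch (fun v => v.mark.isSome)
            (push .used Var.getMark <|
              load (fun v => .idle (v.acc.bit v.getLetter.toBool v.mark)) <|
              goto fun _ => .scan)
            (load (fun v => .idle (v.acc.bit v.getLetter.toBool v.mark)) <|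
              goto fun _ => .scan))
        (branch (fun v => v.getLetter.isState)
          -- The flag of this state was the last letter moved, so it lies on top of `.word` and can
          -- be replaced there.
          (pop .word (fun v x => v.readMark (some (x.getD .slash).toBool)) <|
            push .word (fun v => .bit (v.getMark && v.acc.ok)) <|
            push .word Var.getLetter <|
            load (fun v => .idle (v.acc.endState v.getMark)) <|
            goto fun _ => .rewind)
          (push .word Var.getLetter <|
            load (fun v => .idle (v.acc.sep f v.getLetter)) <|
            goto fun _ => .rewind)))
      (goto fun _ => .clearMarks)
  | .rewind =>
    pop .used Var.readMark <|
    branch (fun v => v.mark.isSome)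
      (push .marks Var.getMark <| load Var.forget <| goto fun _ => .rewind)
      (goto fun _ => .scan)
  | .clearMarks =>
    pop .marks Var.readMark <|
    branch (fun v => v.mark.isSome)
      (load Var.forget <| goto fun _ => .clearMarks)
      (branch (fun v => v.acc.changed)
        (load (fun _ => .idle .start) <| goto fun _ => .load)
        (goto fun _ => .clearWord))
  | .clearWord =>
    pop .word Var.readLetter <|
    branch (fun v => v.letter.isSome)
      (load Var.forget <| goto fun _ => .clearWord)
      -- A halting configuration must have the initial memory and no stack content except the
      -- output, hence the clearing phases.
      (push .marks (fun v => v.acc.init.good f) <|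
        load (fun _ => .idle .start) halt)

/-- The contents of the stacks. -/
def contents (W D : List Letter) (M U : List Bool) : ∀ k : Stack, List k.Alphabet
  | .word => W
  | .done => D
  | .marks => M
  | .used => U

section
variable (W D W' : List Letter) (M U M' : List Bool)

theorem contents_word : contents W D M U .word = W := rfl
theorem contents_done : contents W D M U .done = D := rfl
theorem contents_marks : contents W D M U .marks = M := rfl
theorem contents_used : contents W D M U .used = U := rfl

theorem update_word : Function.update (contents W D M U) .word W' = contents W' D M U := by
  funext k; cases k <;> rfl
theorem update_done : Function.update (contents W D M U) .done W' = contents W W' M U := by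
  funext k; cases k <;> rfl
theorem update_marks : Function.update (contents W D M U) .marks M' = contents W D M' U := by
  funext k; cases k <;> rfl
theorem update_used : Function.update (contents W D M U) .used M' = contents W D M M' := by
  funext k; cases k <;> rfl

end

abbrev Config : Type := TM2.Cfg Stack.Alphabet Label Var

def config (l : Option Label) (a : Acc) (W D : List Letter) (M U : List Bool) : Config :=
  ⟨l, .idle a, contents W D M U⟩

/-- The step function of the machine. -/
def next (f : SyncFun) : Config → Option Config := TM2.step (prog f)

/-- The part of a configuration that changes while the word is scanned. -/
@[ext]
structure Mem where
  acc : Acc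
  word : List Letter
  marks : List Bool
  used : List Bool

/-- The effect of scanning one letter, including the return of the used marks. -/
def Mem.scan (f : SyncFun) (x : Letter) (s : Mem) : Mem :=
  match x with
  | .bit b => ⟨s.acc.bit b s.marks.head?, .bit b :: s.word, s.marks.tail,
      s.marks.head?.toList ++ s.used⟩
  | .state => ⟨s.acc.endState (s.word.head?.getD .slash).toBool,
      .state :: .bit ((s.word.head?.getD .slash).toBool && s.acc.ok) :: s.word.tail,
      s.used.reverse ++ s.marks, []⟩
  | x => ⟨s.acc.sep f x, x :: s.word, s.used.reverse ++ s.marks, []⟩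

/-- The effect of reading one letter while the marks are loaded. -/
def loadMark (s : Bool × List Bool) (x : Letter) : Bool × List Bool :=
  (x.isState, if s.1 then x.toBool :: s.2 else s.2)

/-! ### Single steps and phases of the machine -/

section steps

attribute [local simp] config prog Var.readLetter Var.readMark Var.getLetter Var.getMark Var.forget
  Var.idle contents_word contents_done contents_marks contents_used update_word update_done
  update_marks update_used Letter.isBit Letter.isState Letter.toBool

variable (f : SyncFun) (a : Acc) (W D : List Letter) (M U : List Bool)

theorem next_load (x : Letter) :
    next f (config (some .load) a (x :: W) D M U) =
      some (config (some .load) { a with atFlag := x.isState } W (x :: D)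
        (loadMark (a.atFlag, M) x).2 U) := by
  cases h : a.atFlag <;> simp [next, loadMark, h]

theorem next_load_nil :
    next f (config (some .load) a [] D M U) = some (config (some .scan) .start [] D M U) := by
  simp [next]

theorem next_scan_nil :
    next f (config (some .scan) a W [] M U) = some (config (some .clearMarks) a W [] M U) := by
  simp [next]

theorem next_scan_bit (b : Bool) :
    next f (config (some .scan) a W (.bit b :: D) M U) =
      some (config (some .scan) (a.bit b M.head?) (.bit b :: W) D M.tail
        (M.head?.toList ++ U)) := by
  cases M <;> simp [next]

theorem next_scan_state :
    next f (config (some .scan) a W (.state :: D) M U) =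
      some (config (some .rewind) (a.endState (W.head?.getD .slash).toBool)
        (.state :: .bit ((W.head?.getD .slash).toBool && a.ok) :: W.tail) D M U) := by
  simp [next]

theorem next_scan_sep (x : Letter) (h : x.isBit = false) (h' : x.isState = false) :
    next f (config (some .scan) a W (x :: D) M U) =
      some (config (some .rewind) (a.sep f x) (x :: W) D M U) := by
  cases x <;> simp [next] at *

theorem next_rewind (m : Bool) :
    next f (config (some .rewind) a W D M (m :: U)) =
      some (config (some .rewind) a W D (m :: M) U) := by
  simp [next]

theorem next_rewind_nil :
    next f (config (some .rewind) a W D M []) = some (config (some .scan) a W D M []) := by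
  simp [next]

theorem next_clearMarks (m : Bool) :
    next f (config (some .clearMarks) a W D (m :: M) U) =
      some (config (some .clearMarks) a W D M U) := by
  simp [next]

theorem next_clearMarks_nil :
    next f (config (some .clearMarks) a W D [] U) =
      some (if a.changed then config (some .load) .start W D [] U
        else config (some .clearWord) a W D [] U) := by
  cases h : a.changed <;> simp [next, h]

theorem next_clearWord (x : Letter) :
    next f (config (some .clearWord) a (x :: W) D M U) =
      some (config (some .clearWord) a W D M U) := by
  simp [next]

theorem next_clearWord_nil :
    next f (config (some .clearWord) a [] D M U) =
      some (config none .start [] D (a.init.good f :: M) U) := by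
  simp [next]

end steps

section runs

variable (f : SyncFun) (a : Acc) (W D : List Letter) (M U : List Bool)

theorem reachesIn_load :
    ReachesIn (next f) (W.length + 1) (config (some .load) a W D M U)
      (config (some .scan) .start [] (W.reverse ++ D) (W.foldl loadMark (a.atFlag, M)).2 U) := by
  induction W generalizing a D M with
  | nil => exact .single (next_load_nil ..)
  | cons x W ih =>
    refine .head (next_load ..) ?_
    rw [List.reverse_cons, List.append_assoc]
    exact ih { a with atFlag := x.isState } (x :: D) (loadMark (a.atFlag, M) x).2

theorem reachesIn_rewind :
    ReachesIn (next f) (U.length + 1) (config (some .rewind) a W D M U)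
      (config (some .scan) a W D (U.reverse ++ M) []) := by
  induction U generalizing M with
  | nil => exact .single (next_rewind_nil ..)
  | cons m U ih =>
    refine .head (next_rewind ..) ?_
    simpa using ih (m :: M)

theorem reachesIn_clearMarks :
    ReachesIn (next f) (M.length + 1) (config (some .clearMarks) a W D M U)
      (if a.changed then config (some .load) .start W D [] U
        else config (some .clearWord) a W D [] U) := by
  induction M with
  | nil => exact .single (next_clearMarks_nil ..)
  | cons m M ih => exact .head (next_clearMarks ..) ih

theorem reachesIn_clearWord :
    ReachesIn (next f) (W.length + 1) (config (some .clearWord) a W D M U)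
      (config none .start [] D (a.init.good f :: M) U) := by
  induction W with
  | nil => exact .single (next_clearWord_nil ..)
  | cons m M ih => exact .head (next_clearWord ..) ih

/-- The configuration in which the letters `D` are still to be scanned. -/
def Mem.config (s : Mem) (l : Label) (D : List Letter) : Config :=
  SyncMDP.config (some l) s.acc s.word D s.marks s.used

/-- The summand `s.used.length` is a potential: a bit takes one step and adds at most one used mark,
and a separator pays for moving back all used marks. -/
theorem reachesIn_scan (s : Mem) :
    ReachesIn (next f) (2 * D.length + s.used.length + 1) (s.config .scan D)
      ((D.foldl (fun s x => s.scan f x) s).config .clearMarks []) := by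
  induction D generalizing s with
  | nil => exact (ReachesIn.single (next_scan_nil ..)).mono (by omega)
  | cons x D ih =>
    have hsep : ∀ a W, next f (s.config .scan (x :: D)) =
          some (SyncMDP.config (some .rewind) a W D s.marks s.used) →
        s.scan f x = ⟨a, W, s.used.reverse ++ s.marks, []⟩ →
        ReachesIn (next f) (2 * (x :: D).length + s.used.length + 1) (s.config .scan (x :: D))
          ((D.foldl (fun s x => s.scan f x) (s.scan f x)).config .clearMarks []) := by
      intro a W h h'
      have hs := ih (s.scan f x)
      rw [h'] at hs ⊢
      refine (ReachesIn.head h ((reachesIn_rewind ..).trans hs)).mono ?_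
      simp only [List.length_cons, List.length_nil]
      omega
    cases x with
    | bit b =>
      refine (ReachesIn.head (next_scan_bit ..) (ih (s.scan f (.bit b)))).mono ?_
      rcases h : s.marks with _ | ⟨m, M⟩
      · simp [Mem.scan, h]
      · simp [Mem.scan, h]
        omega
    | slash => exact hsep _ _ (next_scan_sep f _ _ _ _ _ _ rfl rfl) rfl
    | state => exact hsep _ _ (next_scan_state ..) rfl
    | action => exact hsep _ _ (next_scan_sep f _ _ _ _ _ _ rfl rfl) rfl

end runs
-- The effect of one round on a word made of blocks
/-- The part of the word that presents one state: its mark, the numerator and the denominator of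
its initial probability, and its rows. -/
structure Block where
  flag : Bool
  num : List Bool
  den : List Bool
  rows : List (List Bool)

def rowWord (r : List Bool) : List Letter := .action :: r.map .bit

def Block.word (b : Block) : List Letter :=
  [Letter.state, .bit b.flag] ++ b.num.map .bit ++ [.slash] ++ b.den.map .bit
    ++ b.rows.flatMap rowWord

theorem foldl_loadMark_bits (l : List Bool) (M : List Bool) :
    (l.map Letter.bit).foldl loadMark (false, M) = (false, M) := by
  induction l with
  | nil => rfl
  | cons b l ih => exact ih

theorem foldl_loadMark_rows (L : List (List Bool)) (M : List Bool) :
    (L.flatMap rowWord).foldl loadMark (false, M) = (false, M) := by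
  induction L with
  | nil => rfl
  | cons r L ih =>
    rw [List.flatMap_cons, List.foldl_append]
    exact (congrArg (fun s => (L.flatMap rowWord).foldl loadMark s)
      (foldl_loadMark_bits r M)).trans ih

theorem foldl_loadMark_block (b : Block) (M : List Bool) :
    b.word.foldl loadMark (false, M) = (false, b.flag :: M) := by
  simp only [Block.word, List.foldl_append]
  have h : [Letter.state, .bit b.flag].foldl loadMark (false, M) = (false, b.flag :: M) := rfl
  rw [h, foldl_loadMark_bits]
  have h : [Letter.slash].foldl loadMark (false, b.flag :: M) = (false, b.flag :: M) := rfl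
  rw [h, foldl_loadMark_bits, foldl_loadMark_rows]

theorem foldl_loadMark_word (B : List Block) (M : List Bool) :
    (B.flatMap Block.word).foldl loadMark (false, M) =
      (false, (B.map Block.flag).reverse ++ M) := by
  induction B generalizing M with
  | nil => rfl
  | cons b B ih =>
    rw [List.flatMap_cons, List.foldl_append, foldl_loadMark_block, ih]
    simp

variable (f : SyncFun)

/-- The status of a row, given the marks. -/
def rowStatus (marks r : List Bool) : Status :=
  (r.zip marks).foldr (fun p s => s.add p.1 p.2) .start

/-- Bits of numbers use up marks to no purpose. Only the invariance of `U.reverse ++ M` matters, as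
the next separator restores the marks from it. -/
theorem foldr_scan_bits (l : List Bool) (a : Acc) (W : List Letter) (M U : List Bool)
    (ha : a.bits = false) (ha' : a.more = false) :
    ∃ row M' U', U'.reverse ++ M' = U.reverse ++ M ∧
      (l.map Letter.bit).foldr (Mem.scan f) ⟨a, W, M, U⟩ =
        ⟨{ a with row := row, bits := !l.isEmpty, more := !l.tail.isEmpty },
          l.map .bit ++ W, M', U'⟩ := by
  induction l with
  | nil =>
    refine ⟨a.row, M, U, rfl, ?_⟩
    rcases a
    simp_all
  | cons b l ih =>
    obtain ⟨row, M', U', h, h'⟩ := ih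
    rw [List.map_cons, List.foldr_cons, h']
    refine ⟨row.add b (M'.head?.getD false), M'.tail, M'.head?.toList ++ U', ?_, rfl⟩
    rw [← h]
    cases M' <;> simp

/-- Loading puts the mark of the last state on top, so the right-to-left scan pairs each bit with
the mark of its own state. `M` makes the induction work. -/
theorem foldr_scan_rowBits (r marks : List Bool) (h : r.length = marks.length) (a : Acc)
    (W : List Letter) (M : List Bool) (ha : a.row = .start) :
    ∃ b c, (r.map Letter.bit).foldr (Mem.scan f) ⟨a, W, marks.reverse ++ M, []⟩ =
        ⟨{ a with row := rowStatus marks r, bits := b, more := c },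
          r.map .bit ++ W, M, marks⟩ := by
  induction r generalizing marks M with
  | nil =>
    obtain rfl := List.length_eq_zero_iff.1 h.symm
    refine ⟨a.bits, a.more, ?_⟩
    rcases a
    simp_all [rowStatus]
  | cons b r ih =>
    obtain _ | ⟨m, marks⟩ := marks
    · simp at h
    obtain ⟨c, d, h'⟩ := ih marks (by simpa using h) (m :: M)
    rw [List.reverse_cons, List.append_assoc, List.map_cons, List.foldr_cons]
    exact ⟨true, c, congrArg (Mem.scan f (.bit b)) h'⟩

theorem foldr_scan_row (r marks : List Bool) (h : r.length = marks.length) (ok ch : Bool)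
    (i : Status) (W : List Letter) :
    (rowWord r).foldr (Mem.scan f) ⟨.clean ok ch i, W, marks.reverse, []⟩ =
      ⟨.clean (ok || (rowStatus marks r).good f) ch i, rowWord r ++ W, marks.reverse, []⟩ := by
  obtain ⟨b, c, h'⟩ := foldr_scan_rowBits f r marks h (.clean ok ch i) W [] rfl
  rw [List.append_nil] at h'
  rw [rowWord, List.foldr_cons, h']
  simp [Mem.scan, Acc.sep, Acc.clean]

theorem foldr_scan_rows (L : List (List Bool)) (marks : List Bool)
    (h : ∀ r ∈ L, r.length = marks.length) (ch : Bool) (i : Status) (W : List Letter) :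
    (L.flatMap rowWord).foldr (Mem.scan f) ⟨.clean false ch i, W, marks.reverse, []⟩ =
      ⟨.clean (L.any fun r => (rowStatus marks r).good f) ch i, L.flatMap rowWord ++ W,
        marks.reverse, []⟩ := by
  induction L with
  | nil => rfl
  | cons r L ih =>
    rw [List.forall_mem_cons] at h
    rw [List.flatMap_cons, List.foldr_append, ih h.2, foldr_scan_row f r marks h.1, List.any_cons,
      List.append_assoc, Bool.or_comm]

/-- The mark of a state is kept if one of the rows is good. -/
def Block.update (marks : List Bool) (b : Block) : Block :=
  { b with flag := b.flag && b.rows.any fun r => (rowStatus marks r).good f }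

theorem foldr_scan_block (b : Block) (marks : List Bool)
    (h : ∀ r ∈ b.rows, r.length = marks.length) (ch : Bool) (i : Status) (W : List Letter) :
    b.word.foldr (Mem.scan f) ⟨.clean false ch i, W, marks.reverse, []⟩ =
      ⟨.clean false (ch || (b.flag && !(b.update f marks).flag))
        (i.add (!b.num.isEmpty) (b.update f marks).flag), (b.update f marks).word ++ W,
        marks.reverse, []⟩ := by
  set ok := b.rows.any fun r => (rowStatus marks r).good f with hok
  -- The flag is grouped with the numerator, since no separator stands between them.
  have e : b.word = .state :: (((b.flag :: b.num).map .bit) ++ (.slash :: (b.den.map .bit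
      ++ b.rows.flatMap rowWord))) := by simp [Block.word]
  rw [e, List.foldr_cons, List.foldr_append, List.foldr_cons, List.foldr_append,
    foldr_scan_rows f _ _ h, ← hok]
  obtain ⟨row, M, U, hU, h1⟩ := foldr_scan_bits f b.den (.clean ok ch i)
    (b.rows.flatMap rowWord ++ W) marks.reverse [] rfl rfl
  rw [h1]
  have h2 : ∀ a W, Mem.scan f .slash ⟨a, W, M, U⟩ =
      ⟨.clean a.ok a.changed a.init, .slash :: W, marks.reverse, []⟩ := fun a W => by
    simp [Mem.scan, Acc.sep, hU]
  rw [h2]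
  obtain ⟨row, M, U, hU, h1⟩ := foldr_scan_bits f (b.flag :: b.num) (.clean ok ch i)
    (.slash :: (b.den.map .bit ++ (b.rows.flatMap rowWord ++ W))) marks.reverse [] rfl rfl
  refine (congrArg (Mem.scan f .state) h1).trans ?_
  cases hb : b.flag <;>
    simp [Mem.scan, hU, Acc.endState, Acc.clean, Block.update, Block.word, hb, Letter.toBool,
      ← hok]

/-- The status of the support of the initial distribution. -/
def initStatus (B : List Block) : Status :=
  B.foldr (fun b s => s.add (!b.num.isEmpty) b.flag) .start

theorem foldr_scan_word (B : List Block) (marks : List Bool)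
    (h : ∀ b ∈ B, ∀ r ∈ b.rows, r.length = marks.length) :
    (B.flatMap Block.word).foldr (Mem.scan f) ⟨.start, [], marks.reverse, []⟩ =
      ⟨.clean false (B.any fun b => b.flag && !(b.update f marks).flag)
        (initStatus (B.map (Block.update f marks))),
        (B.map (Block.update f marks)).flatMap Block.word, marks.reverse, []⟩ := by
  induction B with
  | nil => rfl
  | cons b B ih =>
    rw [List.forall_mem_cons] at h
    rw [List.flatMap_cons, List.foldr_append, ih h.2, foldr_scan_block f b marks h.1]
    rw [List.any_cons, Bool.or_comm]
    rfl

/-- The marks stay fixed during the scan, so all states are updated simultaneously. Loading takes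
`|W| + 1` steps, scanning `2|W| + 1`, clearing the marks `|B| + 1`. -/
theorem reachesIn_round (B : List Block)
    (h : ∀ b ∈ B, ∀ r ∈ b.rows, r.length = B.length) :
    let B' := B.map (Block.update f (B.map Block.flag))
    let W := B.flatMap Block.word
    ReachesIn (next f) (3 * W.length + B.length + 3) (config (some .load) .start W [] [] [])
      (if B.any fun b => b.flag && !(b.update f (B.map Block.flag)).flag
        then config (some .load) .start (B'.flatMap Block.word) [] [] []
        else config (some .clearWord) (.clean false false (initStatus B'))
          (B'.flatMap Block.word) [] [] []) := by
  intro B' W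
  have h1 := reachesIn_load f .start W [] [] []
  have e : Acc.start.atFlag = false := rfl
  rw [e, foldl_loadMark_word, List.append_nil, List.append_nil] at h1
  have h2 := reachesIn_scan f W.reverse ⟨.start, [], (B.map Block.flag).reverse, []⟩
  rw [List.foldl_reverse] at h2
  rw [show (fun x y => Mem.scan f x y) = Mem.scan f from rfl,
    foldr_scan_word f B _ (by simpa using h)] at h2
  have h3 := ((h1.trans h2).trans (reachesIn_clearMarks ..)).mono
    (t := 3 * W.length + B.length + 3) (by simp; omega)
  cases hc : B.any fun b => b.flag && !(b.update f (B.map Block.flag)).flag <;>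
    rw [hc] at h3 <;> exact h3

/-! ### Refinement to the greatest safe subset -/

namespace Input

variable (x : Input)

open Classical in
/-- The part of the word that presents the state `q`, with the set `S` instead of the target
set. -/
noncomputable def block (S : Fin x.n → Bool) (q : Fin x.n) : Block where
  flag := S q
  num := Computability.encodeNat (x.μ₀.1 q).num.natAbs
  den := Computability.encodeNat (x.μ₀.1 q).den
  rows := (List.finRange x.m).map fun a =>
    (List.finRange x.n).map fun q' => decide (q' ∈ x.M.post q a)

noncomputable def blocks (S : Fin x.n → Bool) : List Block := (List.finRange x.n).map (x.block S)

noncomputable def word (S : Fin x.n → Bool) : List Letter := (x.blocks S).flatMap Block.word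

open Classical in
theorem encode_eq_word : x.encode = x.word fun q => decide (q ∈ x.T) := by
  simp only [encode, word, blocks, List.flatMap_map]
  congr 1
  funext q
  simp only [Block.word, block, List.flatMap_map, rowWord, List.map_map, Function.comp_def]

/-- The states of `S` from which some action leads to a support that fits `S`. -/
noncomputable def refine (S : Fin x.n → Bool) (q : Fin x.n) : Bool :=
  ((x.block S q).update f ((x.blocks S).map Block.flag)).flag

theorem map_flag_blocks (S : Fin x.n → Bool) :
    (x.blocks S).map Block.flag = (List.finRange x.n).map S := by
  rw [blocks, List.map_map]
  rfl

theorem refine_eq_true (S : Fin x.n → Bool) (q : Fin x.n) :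
    x.refine f S q = true ↔
      S q = true ∧ ∃ a, Fits f (x.M.post q a) {q | S q = true} := by
  classical
  rw [refine, map_flag_blocks]
  simp only [Block.update, block, Bool.and_eq_true, List.any_map, List.any_eq_true,
    List.mem_finRange, true_and, Function.comp_apply]
  refine and_congr Iff.rfl (exists_congr fun a => ?_)
  have h := Status.good_ofList (fun q' => decide (q' ∈ x.M.post q a)) S
    (List.nodup_finRange x.n) List.mem_finRange f
  simp only [decide_eq_true_eq] at h
  refine Iff.trans (Eq.congr_left ?_) h
  rw [rowStatus, List.zip_map', List.foldr_map]
  rfl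

theorem refine_le {S : Fin x.n → Bool} {q : Fin x.n} (h : x.refine f S q = true) : S q = true :=
  ((x.refine_eq_true f S q).1 h).1

theorem map_update_blocks (S : Fin x.n → Bool) :
    (x.blocks S).map (Block.update f ((x.blocks S).map Block.flag)) =
      x.blocks (x.refine f S) := by
  rw [blocks, List.map_map]
  rfl

/-- This lets the machine detect positive initial probability without arithmetic. -/
theorem encodeNat_isEmpty (k : ℕ) : (Computability.encodeNat k).isEmpty = true ↔ k = 0 := by
  constructor
  · intro h
    rw [← Computability.decode_encodeNat k, List.isEmpty_iff.1 h]
    rfl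
  · rintro rfl
    rfl

theorem initStatus_blocks (S : Fin x.n → Bool) :
    (initStatus (x.blocks S)).good f = true ↔ Fits f x.init.supp {q | S q = true} := by
  have h := Status.good_ofList
    (fun q => !(Computability.encodeNat (x.μ₀.1 q).num.natAbs).isEmpty) S
    (List.nodup_finRange x.n) List.mem_finRange f
  have e : {q | (!(Computability.encodeNat (x.μ₀.1 q).num.natAbs).isEmpty) = true} =
      x.init.supp := by
    ext q
    have h0 : 0 ≤ x.μ₀.1 q := x.μ₀.2.1 q
    have h1 : q ∈ x.init.supp ↔ 0 < x.μ₀.1 q := Rat.cast_pos (K := ℝ)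
    rw [h1, h0.lt_iff_ne', Set.mem_ofPred_eq, Bool.not_eq_true', ← Bool.not_eq_true,
      encodeNat_isEmpty, Int.natAbs_eq_zero, Rat.num_eq_zero]
  rw [e] at h
  refine Iff.trans (Eq.congr_left ?_) h
  rw [initStatus, blocks, List.foldr_map]
  rfl

/-- Flags have constant width, so the word keeps its length in all rounds. -/
theorem length_word (S : Fin x.n → Bool) : (x.word S).length = x.encode.length := by
  rw [encode_eq_word, word, word, blocks, blocks]
  simp only [List.flatMap_map, List.length_flatMap]
  congr 2

theorem le_length_encode : x.n ≤ x.encode.length := by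
  rw [← x.length_word fun _ => false, word, blocks]
  simp only [List.flatMap_map, List.length_flatMap]
  calc x.n = ((List.finRange x.n).map fun _ => 1).sum := by simp
    _ ≤ _ := List.sum_le_sum fun q _ => by simp [Block.word]

theorem isSafe_of_refine_eq {S : Fin x.n → Bool} (h : x.refine f S = S) :
    x.M.IsSafe f {q | S q = true} := fun q hq => by
  have hq : S q = true := hq
  rw [← h] at hq
  exact ((x.refine_eq_true f S q).1 hq).2

/-- Fitting is monotone in the ambient set, so a deletion never hits a safe subset. -/
theorem subset_refine {S : Fin x.n → Bool} {R : Set (Fin x.n)} (hR : x.M.IsSafe f R)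
    (hRS : R ⊆ {q | S q = true}) : R ⊆ {q | x.refine f S q = true} := fun q hq =>
  (x.refine_eq_true f S q).2 ⟨hRS hq, (hR q hq).imp fun _ ha => ha.mono hRS⟩

theorem any_blocks_changed (S : Fin x.n → Bool) :
    ((x.blocks S).any fun b =>
        b.flag && !(b.update f ((x.blocks S).map Block.flag)).flag) = true ↔
      ∃ q, S q = true ∧ x.refine f S q = false := by
  rw [blocks, List.any_map, List.any_eq_true, ← blocks]
  simp [refine, block]

/-- The machine, started with the marks `S`, computes the greatest safe subset of `S`. -/
theorem reachesIn_answer (c : ℕ) (S : Fin x.n → Bool)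
    (hc : (Finset.univ.filter fun q => S q = true).card = c) :
    ∃ S' : Fin x.n → Bool, {q | S' q = true} ⊆ {q | S q = true} ∧
      x.M.IsSafe f {q | S' q = true} ∧
      (∀ R : Set (Fin x.n), x.M.IsSafe f R → R ⊆ {q | S q = true} → R ⊆ {q | S' q = true}) ∧
      ReachesIn (next f) ((c + 1) * (4 * x.encode.length + 3) + (x.encode.length + 1))
        (config (some .load) .start (x.word S) [] [] [])
        (config none .start [] [] [(initStatus (x.blocks S')).good f] []) := by
  induction c using Nat.strong_induction_on generalizing S with
  | _ c ih =>
  have hround := (reachesIn_round f (x.blocks S) (by simp [blocks, block])).mono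
    (t := 4 * x.encode.length + 3) (by
      have h1 := x.length_word S
      have h2 := x.le_length_encode
      have h3 : (x.blocks S).length = x.n := by simp [blocks]
      rw [word] at h1
      omega)
  simp only [map_update_blocks] at hround
  by_cases hch : ∃ q, S q = true ∧ x.refine f S q = false
  · rw [if_pos ((x.any_blocks_changed f S).2 hch)] at hround
    obtain ⟨q, hq, hq'⟩ := hch
    -- A round that changes something removes a mark, so at most `c + 1` rounds occur, the last one
    -- confirming the fixpoint.
    have hlt : (Finset.univ.filter fun q => x.refine f S q = true).card < c := by
      rw [← hc]
      refine Finset.card_lt_card (Finset.ssubset_iff_of_subset ?_ |>.2 ⟨q, ?_, ?_⟩)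
      · intro q h
        simp only [Finset.mem_filter, Finset.mem_univ, true_and] at h ⊢
        exact x.refine_le f h
      · simpa using hq
      · simpa using hq'
    obtain ⟨S', h1, h2, h3, h4⟩ := ih _ hlt (x.refine f S) rfl
    refine ⟨S', fun q h => x.refine_le f (h1 h), h2,
      fun R hR hRS => h3 R hR (x.subset_refine f hR hRS), (hround.trans h4).mono ?_⟩
    rw [← add_assoc, Nat.add_le_add_iff_right, add_comm, ← Nat.succ_mul]
    exact Nat.mul_le_mul_right _ (by omega)
  · rw [if_neg (mt (x.any_blocks_changed f S).1 hch)] at hround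
    have hS : x.refine f S = S := by
      funext q
      cases h : S q
      · rw [← Bool.not_eq_true] at h ⊢
        exact mt (x.refine_le f) h
      · by_contra h'
        exact hch ⟨q, h, by simpa using h'⟩
    rw [hS] at hround
    have hclear := reachesIn_clearWord f (.clean false false (initStatus (x.blocks S)))
      (x.word S) [] [] []
    rw [length_word] at hclear
    refine ⟨S, subset_rfl, x.isSafe_of_refine_eq f hS, fun R _ h => h,
      (hround.trans hclear).mono ?_⟩
    rw [Nat.add_le_add_iff_right]
    exact Nat.le_mul_of_pos_left _ (Nat.succ_pos c)

end Input

/-! ### The polynomial-time decision -/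

/-- The machine that decides the membership problem. -/
noncomputable def machine : FinTM2 where
  K := Stack
  k₀ := .word
  k₁ := .marks
  Γ := Stack.Alphabet
  Λ := Label
  main := .load
  σ := Var
  initialState := .idle .start
  Γk₀Fin := inferInstanceAs (Fintype Letter)
  m := prog f

theorem initList_machine (W : List Letter) :
    initList (machine f) W = config (some .load) .start W [] [] [] := by
  refine congrArg (TM2.Cfg.mk (some Label.load) (Var.idle .start)) ?_
  funext k
  cases k <;> rfl

theorem haltList_machine (b : List Bool) :
    haltList (machine f) b = config none .start [] [] b [] := by
  refine congrArg (TM2.Cfg.mk none (Var.idle .start)) ?_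
  funext k
  cases k <;> rfl

theorem Input.reachesIn_decision (x : Input) (w : Mode)
    [Decidable (x.init ∈ x.M.winAlways w (f.eval x.T))] :
    ReachesIn (next f) (4 * (x.encode.length + 1) ^ 2)
      (config (some .load) .start x.encode [] [] [])
      (config none .start [] [] [decide (x.init ∈ x.M.winAlways w (f.eval x.T))] []) := by
  classical
  obtain ⟨S, h1, h2, h3, h4⟩ := x.reachesIn_answer f _ (fun q => decide (q ∈ x.T)) rfl
  rw [← encode_eq_word] at h4
  have e : (initStatus (x.blocks S)).good f =
      decide (x.init ∈ x.M.winAlways w (f.eval x.T)) := by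
    rw [Bool.eq_iff_iff, decide_eq_true_iff, x.initStatus_blocks f S, MDP.mem_winAlways_iff]
    constructor
    · exact fun h => ⟨_, fun q hq => by simpa using h1 hq, h, h2⟩
    · rintro ⟨R, hRT, h, hR⟩
      -- Any safe witness `R ⊆ T` lies in the greatest one, so testing the latter loses nothing.
      exact h.mono (h3 R hR fun q hq => by simpa using hRT hq)
  rw [e] at h4
  refine h4.mono ?_
  have hle : (Finset.univ.filter fun q => decide (q ∈ x.T) = true).card ≤ x.encode.length :=
    (Finset.card_le_univ _).trans (by simpa using x.le_length_encode)
  calc _ ≤ (x.encode.length + 1) * (4 * x.encode.length + 3) + (x.encode.length + 1) :=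
        Nat.add_le_add_right (Nat.mul_le_mul_right _ (by omega)) _
    _ = _ := by ring

theorem decidableInPolyTime_winAlways (w : Mode) :
    DecidableInPolyTime Input.encode fun x => x.init ∈ x.M.winAlways w (f.eval x.T) := by
  classical
  refine ⟨{
    tm := machine f
    inputAlphabet := Equiv.refl Letter
    outputAlphabet := Equiv.refl Bool
    time := 4 * (Polynomial.X + 1) ^ 2
    outputsFun := fun x => Classical.choice ?_ }⟩
  obtain ⟨k, hk, h⟩ := x.reachesIn_decision f w
  rw [← initList_machine f, ← haltList_machine f, ← List.map_id x.encode] at h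
  refine ⟨⟨⟨k, ?_⟩, ?_⟩⟩
  · exact h
  · simpa using hk

end SyncMDP

theorem mainTheorem5 (f : SyncMDP.SyncFun) (w : SyncMDP.Mode) :
    SyncMDP.DecidableInPolyTime SyncMDP.Input.encode
      (fun x => x.init ∈ x.M.winAlways w (f.eval x.T)) ∧
    ∀ (Q A : Type*) [Fintype Q] [Fintype A] (M : SyncMDP.MDP Q A) (T : Finset Q)
      (μ₀ : SyncMDP.Distr Q), μ₀ ∈ M.winAlways w (f.eval T) →
        M.AlwaysWinningWith {α | α.IsPure ∧ α.IsMemoryless} (f.eval T) μ₀ w := by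
  refine ⟨SyncMDP.decidableInPolyTime_winAlways f w, fun Q A _ _ M T μ₀ h => ?_⟩
  obtain ⟨S, hT, h0, hS⟩ := (M.mem_winAlways_iff f T μ₀ w).1 h
  exact M.winning_of_isSafe f T μ₀ hT h0 hS w
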